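/- **Setting.** Let $m\ge 1$ be an integer and let $H_0,\dots,H_m$ be nonzero real Hilbert spaces with $H_m=H_0=H$. For every $i\in\{1,\dots,m\}$ and $n\in\mathbb N$ let $W_{i,n}\colon H_{i-1}\to H_i$ be a bounded linear operator, $b_{i,n}\in H_i$, $R_{i,n}\colon H_i\to H_i$, and $T_{i,n}x=R_{i,n}(W_{i,n}x+b_{i,n})$. Let $x_0\in H$, let $(\lambda_n)_{n\in\mathbb N}$ be a sequence in $]0,+\infty[$ and, for every $n\in\mathbb N$, set $$x_{1,n}=T_{1,n}x_n,\quad x_{2,n}=T_{2,n}x_{1,n},\ \dots,\ x_{m,n}=T_{m,n}x_{m-1,n},\qquad x_{n+1}=x_n+\lambda_n(x_{m,n}-x_n).$$ For a real Hilbert space $E$, $\Gamma_0(E)$ is the set of lower semicontinuous convex functions $\varphi\colon E\to\,]-\infty,+\infty]$ that are not identically $+\infty$, and $\operatorname{prox}_\varphi x$ is the unique minimizer of $y\mapsto\varphi(y)+\|x-y\|^2/2$; $\partial\varphi$ is the subdifferential, i.e., $u\in\partial\varphi(x)$ if and only if $\varphi(x)+\langle y-x,u\rangle\le\varphi(y)$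 for every $y\in E$. Suppose that, for every $i\in\{1,\dots,m\}$, there are a bounded linear operator $W_i\colon H_{i-1}\to H_i$, a vector $b_i\in H_i$ and an operator $R_i=\operatorname{prox}_{\varphi_i}$, where $\varphi_i\in\Gamma_0(H_i)$ is minimal at $0$; and that there are summable sequences $(\omega_n),(\rho_n),(\eta_n),(\nu_n)$ in $[0,+\infty[$ such that, for all $i\in\{1,\dots,m\}$, $n\in\mathbb N$ and $x\in H_i$, $$\|W_{i,n}-W_i\|\le\omega_n,\qquad \|R_{i,n}x-R_ix\|\le\rho_n\|x\|+\eta_n,\qquad \|b_{i,n}-b_i\|\le\nu_n .$$ Set $T_ix=R_i(W_ix+b_i)$, $T=T_m\circ\cdots\circ T_1$ and $F=\operatorname{Fix}T$. Let $\alpha\in[1/2,1]$, and for $i\in\{1,\dots,m\}$ set $L_i(v_0,\dots,v_{i-1})=\sum_{k=0}^{i-1}(W_i\circ\cdots\circ W_{k+1})v_k$ for $(v_0,\dots,v_{i-1})\in H_0\times\cdots\times H_{i-1}$. **Theorem.** Suppose that the following hold. (a) $F\neq\varnothing$. (b) For every $v=(v_0,\dots,v_{m-1})\in H_0\times\cdots\times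 H_{m-1}$ such that $\|v_0\|\le1$ and $\|v_i\|\le\|L_i(v_0,\dots,v_{i-1})\|$ for $1\le i\le m-1$, $$\|L_mv-2^m(1-\alpha)v_0\|+\|L_mv\|\le2^m\alpha\|v_0\|.$$ (c) One of the following is satisfied: (i) $\alpha=1$, $\lambda_n=1$ for every $n$, and $Tx_n-x_n\to0$; (ii) $\lambda_n\in\,]0,1/\alpha[$ for every $n$ and $\sum_{n\in\mathbb N}\lambda_n(1-\alpha\lambda_n)=+\infty$. Then $(x_n)$ converges weakly to a point $\overline x_m\in F$, and the tuple $$(\overline x_1,\dots,\overline x_m)=(T_1\overline x_m,\ (T_2\circ T_1)\overline x_m,\ \dots,\ (T_{m-1}\circ\cdots\circ T_1)\overline x_m,\ \overline x_m)$$ solves the variational inequality $$b_1\in\overline x_1-W_1\overline x_m+\partial\varphi_1(\overline x_1),\qquad b_i\in\overline x_i-W_i\overline x_{i-1}+\partial\varphi_i(\overline x_i)\quad(2\le i\le m).$$ Suppose that, in addition, any one of the following holds: (d) for every $i\in\{1,\dots,m-1\}$, $R_i$ is weakly sequentially continuous; (e) for every $i\in\{1,\dots,m-1\}$, $R_i$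 is separable: there are an orthonormal basis $(e_k)_{k\in K}$ of $H_i$ with $K\subset\mathbb N$, and functions $\phi_k\in\Gamma_0(\mathbb R)$ with $\phi_k\ge\phi_k(0)=0$, such that $R_ix=\sum_{k\in K}\operatorname{prox}_{\phi_k}(\langle x,e_k\rangle)\,e_k$ for every $x\in H_i$; (f) for every $i\in\{1,\dots,m-1\}$, $H_i$ is finite-dimensional; (g) for some $\varepsilon\in\,]0,1/2[$, $\lambda_n\in[\varepsilon,(1-\varepsilon)(\varepsilon+1/\alpha)]$ for every $n$; moreover, for every $i\in\{1,\dots,m\}$, $H_i=H$ and there exists $\beta_i\in\,]0,1[$ such that $\|W_i-2(1-\beta_i)\operatorname{Id}\|+\|W_i\|\le2\beta_i$. Then, for every $i\in\{1,\dots,m-1\}$, $(x_{i,n})_{n\in\mathbb N}$ converges weakly to $\overline x_i=(T_i\circ\cdots\circ T_1)\overline x_m$, and $(\overline x_1,\dots,\overline x_m)$ solves the variational inequality above. -/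

import Mathlib

open Filter Topology
open scoped InnerProductSpace

universe u

namespace ProxNet

noncomputable section

/-! ### Convex analysis on a real Hilbert space -/

section ConvexAnalysis

variable {E : Type u} [NormedAddCommGroup E] [InnerProductSpace ℝ E]

/-- `Γ₀(E)`: the lower semicontinuous convex functions `E → ]-∞,+∞]` that are not identically
`+∞`. -/
structure IsGammaZero (φ : E → EReal) : Prop where
  ne_bot : ∀ x, φ x ≠ ⊥
  proper : ∃ x, φ x ≠ ⊤
  convex : ∀ x y : E, ∀ a b : ℝ, 0 < a → 0 < b → a + b = 1 →
    φ (a • x + b • y) ≤ (a : EReal) * φ x + (b : EReal) * φ y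
  lsc : LowerSemicontinuous φ

/-- `R = prox_φ`: for every `x`, the point `R x` minimizes `y ↦ φ y + ‖x - y‖² / 2`
(for `φ ∈ Γ₀(E)` there is exactly one minimizer). -/
def IsProx (φ : E → EReal) (R : E → E) : Prop :=
  ∀ x, IsMinOn (fun y => φ y + ((‖x - y‖ ^ 2 / 2 : ℝ) : EReal)) Set.univ (R x)

/-- `R` is an activation operator of the class `𝒜(E)` with potential `φ`: `φ ∈ Γ₀(E)` is minimal
at the zero vector and `R = prox_φ`. -/
structure IsActivation (φ : E → EReal) (R : E → E) : Prop where
  gammaZero : IsGammaZero φ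
  minimal_zero : ∀ x, φ 0 ≤ φ x
  prox : IsProx φ R

/-- The (Moreau) subdifferential of `φ` at `x`. -/
def subdifferential (φ : E → EReal) (x : E) : Set E :=
  {u | ∀ y, φ x + ((⟪y - x, u⟫_ℝ : ℝ) : EReal) ≤ φ y}

/-- Weak convergence of the sequence `x` to `a`. -/
def WeakLim (x : ℕ → E) (a : E) : Prop :=
  Tendsto (fun n => toWeakSpace ℝ E (x n)) atTop (𝓝 (toWeakSpace ℝ E a))

/-- Weak sequential continuity of an operator. -/
def WeakSeqContinuous (R : E → E) : Prop :=
  ∀ (y : ℕ → E) (a : E), WeakLim y a → WeakLim (fun n => R (y n)) (R a)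

/-- `R` is a separable activation operator: for an orthonormal basis `(e_k)` indexed by a set
`K ⊆ ℕ` and functions `φ_k ∈ Γ₀(ℝ)` with `φ_k ≥ φ_k(0) = 0`,
`R x = ∑ₖ prox_{φ_k}(⟪x, e_k⟫) e_k`. -/
def IsSeparableActivation (R : E → E) : Prop :=
  ∃ (K : Set ℕ) (e : HilbertBasis K ℝ E) (φ : K → ℝ → EReal) (r : K → ℝ → ℝ),
    (∀ k, IsGammaZero (φ k) ∧ φ k 0 = 0 ∧ (∀ t, 0 ≤ φ k t) ∧ IsProx (φ k) (r k)) ∧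
    ∀ x, HasSum (fun k => r k ⟪x, e k⟫_ℝ • e k) (R x)

end ConvexAnalysis

/-- The sequences in `ℓ¹₊`. -/
def IsEllOnePos (a : ℕ → ℝ) : Prop :=
  (∀ n, 0 ≤ a n) ∧ Summable a

/-! ### Networks

The spaces `H₀, …, H_m` are `H : Fin (m + 1) → Type u`. The layer with index `i : Fin m` maps
`H i.castSucc` to `H i.succ`; it is the layer numbered `i + 1` when layers are counted from `1`.
The requirement `H_m = H₀` is expressed by an isometric identification
`J : H (Fin.last m) ≃ₗᵢ[ℝ] H 0`. -/

section Networks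

variable {m : ℕ} {H : Fin (m + 1) → Type u} [∀ i, NormedAddCommGroup (H i)]
  [∀ i, InnerProductSpace ℝ (H i)]

/-- `W_i ∘ ⋯ ∘ W_{k+1} : H_k → H_i` when `k ≤ i` (the identity when `k = i`);
zero when `i < k`. -/
def weightComp (W : ∀ i : Fin m, H i.castSucc →L[ℝ] H i.succ) (k : Fin (m + 1)) :
    ∀ i : Fin (m + 1), H k →L[ℝ] H i :=
  Fin.induction
    (if h : k = 0 then h ▸ ContinuousLinearMap.id ℝ (H k) else 0)
    (fun i A => if h : k = i.succ then h ▸ ContinuousLinearMap.id ℝ (H k) else (W i).comp A)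

theorem weightComp_self (W : ∀ i : Fin m, H i.castSucc →L[ℝ] H i.succ) (k : Fin (m + 1)) :
    weightComp W k k = ContinuousLinearMap.id ℝ (H k) := by
  cases k using Fin.cases <;> simp [weightComp]

theorem weightComp_succ (W : ∀ i : Fin m, H i.castSucc →L[ℝ] H i.succ) (k : Fin (m + 1))
    (i : Fin m) (h : k ≤ i.castSucc) :
    weightComp W k i.succ = (W i).comp (weightComp W k i.castSucc) := by
  have hk : k ≠ i.succ := fun e => absurd (e ▸ h) (by simp [Fin.le_def])
  simp [weightComp, hk]

/-- `L_i (x₀, …, x_{i-1}) = ∑_{k < i} (W_i ∘ ⋯ ∘ W_{k+1}) x_k`; only the components of `x` with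
index below `i` enter. -/
def layerSum (W : ∀ i : Fin m, H i.castSucc →L[ℝ] H i.succ) (i : Fin (m + 1))
    (x : ∀ i, H i) : H i :=
  ∑ k ∈ Finset.Iio i, weightComp W k i (x k)

/-- The averagedness condition on `(W_1, …, W_m)` with parameter `α`: for all `x₀, …, x_{m-1}` with
`‖x₀‖ ≤ 1` and `‖x_i‖ ≤ ‖L_i (x₀, …, x_{i-1})‖` for `1 ≤ i ≤ m - 1`,
`‖L_m x - 2^m (1 - α) x₀‖ + ‖L_m x‖ ≤ 2^m α ‖x₀‖`. The last component of the tuple `x` below is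
not used. -/
def AveragedCondition (J : H (Fin.last m) ≃ₗᵢ[ℝ] H 0)
    (W : ∀ i : Fin m, H i.castSucc →L[ℝ] H i.succ) (α : ℝ) : Prop :=
  ∀ x : ∀ i, H i, ‖x 0‖ ≤ 1 →
    (∀ i : Fin (m + 1), 0 < i → i < Fin.last m → ‖x i‖ ≤ ‖layerSum W i x‖) →
    ‖J (layerSum W (Fin.last m) x) - ((2 : ℝ) ^ m * (1 - α)) • x 0‖
      + ‖J (layerSum W (Fin.last m) x)‖ ≤ (2 : ℝ) ^ m * α * ‖x 0‖

variable (H) in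
/-- The data of `m` layers: weights, biases and activation operators. -/
structure Layers where
  /-- the weight operators -/
  W : ∀ i : Fin m, H i.castSucc →L[ℝ] H i.succ
  /-- the biases -/
  b : ∀ i : Fin m, H i.succ
  /-- the activation operators -/
  R : ∀ i : Fin m, H i.succ → H i.succ

/-- One layer, `x ↦ R_i (W_i x + b_i)`. -/
def Layers.layer (N : Layers H) (i : Fin m) (x : H i.castSucc) : H i.succ :=
  N.R i (N.W i x + N.b i)

/-- `T_i ∘ ⋯ ∘ T_1 : H₀ → H_i` (the identity for `i = 0`). -/
def Layers.output (N : Layers H) (i : Fin (m + 1)) (x : H 0) : H i :=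
  Fin.induction (motive := fun i => H i) x (fun i y => N.layer i y) i

/-- `T_m ∘ ⋯ ∘ T_1`, as an operator from `H₀` to itself. -/
def Layers.comp (N : Layers H) (J : H (Fin.last m) ≃ₗᵢ[ℝ] H 0) (x : H 0) : H 0 :=
  J (N.output (Fin.last m) x)

/-- The sequence `x_{n+1} = x_n + λ_n (x_{m,n} - x_n)` started at `x₀`, where
`x_{m,n} = (T_{m,n} ∘ ⋯ ∘ T_{1,n}) x_n`. -/
def iterate (J : H (Fin.last m) ≃ₗᵢ[ℝ] H 0) (N : ℕ → Layers H) (lam : ℕ → ℝ) (x₀ : H 0) :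
    ℕ → H 0
  | 0 => x₀
  | n + 1 => iterate J N lam x₀ n
      + lam n • ((N n).comp J (iterate J N lam x₀ n) - iterate J N lam x₀ n)

/-- The output `x_{i,n} = (T_{i,n} ∘ ⋯ ∘ T_{1,n}) x_n` of layer `i` at iteration `n`. -/
def layerOutput (J : H (Fin.last m) ≃ₗᵢ[ℝ] H 0) (N : ℕ → Layers H) (lam : ℕ → ℝ) (x₀ : H 0)
    (i : Fin (m + 1)) (n : ℕ) : H i :=
  (N n).output i (iterate J N lam x₀ n)

/-- The layers `N n` approach the limit layers `N'` with summable errors, uniformly in the layer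
index. -/
def SummablyClose (N : ℕ → Layers H) (N' : Layers H) : Prop :=
  ∃ ω ρ η ν : ℕ → ℝ, IsEllOnePos ω ∧ IsEllOnePos ρ ∧ IsEllOnePos η ∧ IsEllOnePos ν ∧
    ∀ i : Fin m,
      (∀ n, ‖(N n).W i - N'.W i‖ ≤ ω n) ∧
      (∀ n x, ‖(N n).R i x - N'.R i x‖ ≤ ρ n * ‖x‖ + η n) ∧
      (∀ n, ‖(N n).b i - N'.b i‖ ≤ ν n)

/-- The tuple `(x_1, …, x_m)` solves the variational inequality
`b_1 ∈ x_1 - W_1 x_m + ∂φ_1(x_1)` and `b_i ∈ x_i - W_i x_{i-1} + ∂φ_i(x_i)` for `2 ≤ i ≤ m`.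
The tuple is extended by the component `x_0`, which is `x_m` seen in `H₀`. -/
def SolvesVI (J : H (Fin.last m) ≃ₗᵢ[ℝ] H 0) (N : Layers H) (φ : ∀ i : Fin m, H i.succ → EReal)
    (x : ∀ i, H i) : Prop :=
  x 0 = J (x (Fin.last m)) ∧
  ∀ i : Fin m, ∃ u ∈ subdifferential (φ i) (x i.succ),
    N.b i = x i.succ - N.W i (x i.castSucc) + u

/-- All the spaces are identified with `H₀`, compatibly with `J`, and for every layer there is
`β ∈ ]0,1[` with `‖W_i - 2 (1 - β) Id‖ + ‖W_i‖ ≤ 2 β`. -/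
def LayerwiseAveraged (J : H (Fin.last m) ≃ₗᵢ[ℝ] H 0)
    (W : ∀ i : Fin m, H i.castSucc →L[ℝ] H i.succ) : Prop :=
  ∃ e : ∀ i, H i ≃ₗᵢ[ℝ] H 0, e 0 = LinearIsometryEquiv.refl ℝ (H 0) ∧ e (Fin.last m) = J ∧
    ∀ i : Fin m, ∃ β : ℝ, 0 < β ∧ β < 1 ∧
      ‖W i - (2 * (1 - β)) •
          (((e i.castSucc).trans (e i.succ).symm : H i.castSucc ≃ₗᵢ[ℝ] H i.succ) :
            H i.castSucc →L[ℝ] H i.succ)‖ + ‖W i‖ ≤ 2 * β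

end Networks

end

end ProxNet

namespace ProxNet

section Hilbert

variable {E : Type u} [NormedAddCommGroup E] [InnerProductSpace ℝ E]

/-! ### Weak convergence -/

/-! Each activation is firmly nonexpansive, so `2R - Id` is nonexpansive. For two inputs, let Δ_i be
the difference of the outputs of layer i, and put v_0 = Δ_0 and v_i = 2^i Δ_i - W_i(2^(i-1)
Δ_(i-1)). Then 2^i Δ_i = L_i v + v_i and ‖v_i‖ ≤ ‖L_i v‖, so v is admissible in condition (b), which
with the triangle inequality gives T = (1-α) Id + αQ with Q nonexpansive (`Layers.comp_averaged`).

The iteration is thus a Krasnosel'skiĭ–Mann iteration for Q with relaxations αλ_n. Its errors are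
bounded by a summable sequence times ‖x_n‖ + 1 (`Layers.norm_output_sub_le`). Quasi-Fejér
monotonicity, vanishing residuals, demiclosedness and Opial's argument give the weak limit
(`krasnoselskii_mann`). The variational inequality is the optimality condition of each prox.

For the inner layers, (e) and (f) reduce to the weak continuity in (d), which propagates layer by
layer. Under (g) every layer is averaged, and vanishing of the total norm decrease from x_n - a to T
x_n - T a forces each Δ_i, transported to H_0, to approach x_n - a strongly
(`Layers.tendsto_output_sub_of_layerwise`). -/

theorem weakLim_of_inner [CompleteSpace E] {x : ℕ → E} {a : E}
    (h : ∀ v, Tendsto (fun n => ⟪x n, v⟫_ℝ) atTop (𝓝 ⟪a, v⟫_ℝ)) : WeakLim x a := by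
  refine (WeakBilin.tendsto_iff_forall_eval_tendsto (B := (topDualPairing ℝ E).flip)
    (f := fun n => toWeakSpace ℝ E (x n)) (x := toWeakSpace ℝ E a) ?_).2 ?_
  · intro u v huv
    refine ext_inner_right ℝ fun w => ?_
    have := congrArg (fun f => f (InnerProductSpace.toDual ℝ E w)) huv
    simpa [real_inner_comm] using this
  · intro f
    have hf : ∀ y, ⟪y, (InnerProductSpace.toDual ℝ E).symm f⟫_ℝ = f y := fun y => by
      rw [real_inner_comm, InnerProductSpace.toDual_symm_apply]
    have := h ((InnerProductSpace.toDual ℝ E).symm f)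
    simp only [hf] at this
    exact this

theorem WeakLim.apply {x : ℕ → E} {a : E} (h : WeakLim x a) (f : E →L[ℝ] ℝ) :
    Tendsto (fun n => f (x n)) atTop (𝓝 (f a)) :=
  ((WeakBilin.eval_continuous (topDualPairing ℝ E).flip f).tendsto (toWeakSpace ℝ E a)).comp h

theorem WeakLim.inner {x : ℕ → E} {a : E} (h : WeakLim x a) (v : E) :
    Tendsto (fun n => ⟪x n, v⟫_ℝ) atTop (𝓝 ⟪a, v⟫_ℝ) := by
  simpa only [innerSL_apply_apply, real_inner_comm] using h.apply (innerSL ℝ v)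

theorem WeakLim.map [CompleteSpace E] {F : Type u} [NormedAddCommGroup F] [InnerProductSpace ℝ F]
    [CompleteSpace F] {x : ℕ → E} {a : E} (h : WeakLim x a) (A : E →L[ℝ] F) :
    WeakLim (fun n => A (x n)) (A a) :=
  weakLim_of_inner fun v => by
    simpa only [← ContinuousLinearMap.adjoint_inner_right] using h.inner (A.adjoint v)

theorem WeakLim.add_tendsto [CompleteSpace E] {x y : ℕ → E} {a b : E} (h : WeakLim x a)
    (hy : Tendsto y atTop (𝓝 b)) : WeakLim (fun n => x n + y n) (a + b) :=
  weakLim_of_inner fun v => by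
    simpa only [inner_add_left] using (h.inner v).add (hy.inner tendsto_const_nhds)

theorem WeakLim.exists_norm_le [CompleteSpace E] {x : ℕ → E} {a : E} (h : WeakLim x a) :
    ∃ M, ∀ n, ‖x n‖ ≤ M := by
  obtain ⟨M, hM⟩ := banach_steinhaus (g := fun n => innerSL ℝ (x n)) fun v => by
    obtain ⟨C, hC⟩ := (h.inner v).norm.bddAbove_range
    exact ⟨C, fun n => hC ⟨n, rfl⟩⟩
  exact ⟨M, fun n => by simpa using hM n⟩

/-- A bounded sequence in a Hilbert space has a weak limit along every ultrafilter. -/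
theorem exists_inner_tendsto_ultrafilter [CompleteSpace E] (U : Ultrafilter ℕ) {x : ℕ → E} {M : ℝ}
    (hx : ∀ n, ‖x n‖ ≤ M) : ∃ a, ∀ v, Tendsto (fun n => ⟪x n, v⟫_ℝ) U (𝓝 ⟪a, v⟫_ℝ) := by
  have hb : ∀ v n, |⟪x n, v⟫_ℝ| ≤ M * ‖v‖ := fun v n =>
    (abs_real_inner_le_norm _ _).trans (mul_le_mul_of_nonneg_right (hx n) (norm_nonneg v))
  have hex : ∀ v, ∃ c ∈ Set.Icc (-(M * ‖v‖)) (M * ‖v‖),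
      Tendsto (fun n => ⟪x n, v⟫_ℝ) U (𝓝 c) := fun v => by
    refine isCompact_iff_ultrafilter_le_nhds.1 isCompact_Icc (U.map fun n => ⟪x n, v⟫_ℝ) ?_
    exact le_principal_iff.2 (Filter.mem_map.2 (Filter.univ_mem' fun n => abs_le.1 (hb v n)))
  choose f hf ht using hex
  -- Uniqueness of limits makes the chosen limits linear in `v`; Riesz representation then supplies
  -- the point.
  let L : E →ₗ[ℝ] ℝ :=
    { toFun := f
      map_add' := fun u v => tendsto_nhds_unique (ht (u + v))
        (by simpa only [inner_add_right] using (ht u).add (ht v))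
      map_smul' := fun c v => tendsto_nhds_unique (ht (c • v))
        (by simpa only [inner_smul_right, smul_eq_mul, RingHom.id_apply] using (ht v).const_mul c) }
  refine ⟨(InnerProductSpace.toDual ℝ E).symm
    (L.mkContinuous M fun v => abs_le.2 (hf v)), fun v => ?_⟩
  rw [InnerProductSpace.toDual_symm_apply]
  exact ht v

/-- Ultrafilters finer than `atTop` play the role of weakly convergent subsequences. One of them is
returned so that properties of cluster points can be applied to the limit. -/
theorem exists_weakLim_of_unique [CompleteSpace E] {x : ℕ → E} {M : ℝ} (hx : ∀ n, ‖x n‖ ≤ M)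
    (huniq : ∀ (U V : Ultrafilter ℕ) (a b : E), (U : Filter ℕ) ≤ atTop → (V : Filter ℕ) ≤ atTop →
      (∀ v, Tendsto (fun n => ⟪x n, v⟫_ℝ) U (𝓝 ⟪a, v⟫_ℝ)) →
      (∀ v, Tendsto (fun n => ⟪x n, v⟫_ℝ) V (𝓝 ⟪b, v⟫_ℝ)) → a = b) :
    ∃ a, WeakLim x a ∧ ∃ U : Ultrafilter ℕ, (U : Filter ℕ) ≤ atTop ∧
      ∀ v, Tendsto (fun n => ⟪x n, v⟫_ℝ) U (𝓝 ⟪a, v⟫_ℝ) := by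
  obtain ⟨a, ha⟩ := exists_inner_tendsto_ultrafilter (Ultrafilter.of atTop) hx
  refine ⟨a, weakLim_of_inner fun v => tendsto_iff_ultrafilter _ _ _ |>.2 fun U hU => ?_,
    _, Ultrafilter.of_le _, ha⟩
  obtain ⟨b, hb⟩ := exists_inner_tendsto_ultrafilter U hx
  rw [huniq _ U a b (Ultrafilter.of_le _) hU ha hb]
  exact hb v

/-! ### Proximity operators -/

theorem IsProx.ne_top {φ : E → EReal} {R : E → E} (hφ : IsGammaZero φ) (hR : IsProx φ R) (x : E) :
    φ (R x) ≠ ⊤ := by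
  intro h
  obtain ⟨y, hy⟩ := hφ.proper
  have := hR x (Set.mem_univ y)
  simp only [Set.mem_ofPred_eq, h, EReal.top_add_coe, top_le_iff] at this
  exact EReal.add_ne_top hy (EReal.coe_ne_top _) this

/-- The minimizer p is compared with (1-t)p + ty; after division by t, the quadratic term is of
order t. -/
theorem IsProx.sub_mem_subdifferential {φ : E → EReal} {R : E → E} (hφ : IsGammaZero φ)
    (hR : IsProx φ R) (x : E) : x - R x ∈ subdifferential φ (R x) := by
  intro y
  by_cases hy : φ y = ⊤
  · rw [hy]; exact le_top
  have hp := hR.ne_top hφ x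
  have hmin := hR x
  generalize R x = p at *
  obtain ⟨a, ha⟩ : ∃ a : ℝ, φ p = a := ⟨_, (EReal.coe_toReal hp (hφ.ne_bot p)).symm⟩
  obtain ⟨b, hb⟩ : ∃ b : ℝ, φ y = b := ⟨_, (EReal.coe_toReal hy (hφ.ne_bot y)).symm⟩
  rw [ha, hb, ← EReal.coe_add, EReal.coe_le_coe_iff]
  have key : ∀ t : ℝ, 0 < t → t < 1 →
      t * (a - b + ⟪y - p, x - p⟫_ℝ) ≤ t * (t / 2 * ‖y - p‖ ^ 2) := by
    intro t ht0 ht1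
    have h1 := hφ.convex p y (1 - t) t (by linarith) ht0 (by ring)
    have h2 := hmin (Set.mem_univ ((1 - t) • p + t • y))
    simp only [Set.mem_ofPred_eq] at h2
    have h3 := h2.trans (add_le_add_left h1 _)
    rw [ha, hb] at h3
    norm_cast at h3
    have e : x - ((1 - t) • p + t • y) = (x - p) - t • (y - p) := by module
    rw [e, norm_sub_sq_real (x - p), norm_smul, inner_smul_right, real_inner_comm, mul_pow,
      Real.norm_eq_abs, sq_abs] at h3
    linarith
  by_contra! hcon
  set A := a - b + ⟪y - p, x - p⟫_ℝ with hA
  have hA0 : 0 < A := by rw [hA]; linarith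
  have hB0 : 0 ≤ ‖y - p‖ ^ 2 := by positivity
  set B := ‖y - p‖ ^ 2
  -- This value of t lies below 1 and satisfies tB < A, contradicting A ≤ tB/2.
  have ht0 : 0 < A / (A + B + 1) := by positivity
  have h1 := le_of_mul_le_mul_left
    (key (A / (A + B + 1)) ht0 ((div_lt_one (by positivity)).2 (by linarith))) ht0
  have h2 : A / (A + B + 1) * (A + B + 1) = A := div_mul_cancel₀ _ (by positivity)
  nlinarith

/-- Monotonicity of the subdifferential: the subgradient inequalities at the two prox points are
added. -/
theorem IsProx.firmly_nonexpansive {φ : E → EReal} {R : E → E} (hφ : IsGammaZero φ)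
    (hR : IsProx φ R) (x y : E) : ‖R x - R y‖ ^ 2 ≤ ⟪R x - R y, x - y⟫_ℝ := by
  have h1 := hR.sub_mem_subdifferential hφ x (R y)
  have h2 := hR.sub_mem_subdifferential hφ y (R x)
  have hp := hR.ne_top hφ x
  have hq := hR.ne_top hφ y
  generalize R x = p at *
  generalize R y = q at *
  lift φ p to ℝ using ⟨hp, hφ.ne_bot p⟩ with a
  lift φ q to ℝ using ⟨hq, hφ.ne_bot q⟩ with b
  norm_cast at h1 h2
  have e : ⟪p - q, x - y⟫_ℝ = ‖p - q‖ ^ 2 - ⟪q - p, x - p⟫_ℝ - ⟪p - q, y - q⟫_ℝ := by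
    rw [← real_inner_self_eq_norm_sq, ← neg_sub p q, inner_neg_left, sub_neg_eq_add,
      ← inner_add_right, ← inner_sub_right]
    congr 1; abel
  linarith

theorem IsProx.norm_two_smul_sub_le {φ : E → EReal} {R : E → E} (hφ : IsGammaZero φ)
    (hR : IsProx φ R) (x y : E) : ‖(2 : ℝ) • (R x - R y) - (x - y)‖ ≤ ‖x - y‖ := by
  refine le_of_sq_le_sq ?_ (norm_nonneg _)
  rw [norm_sub_sq_real, norm_smul, inner_smul_left, mul_pow]
  have := hR.firmly_nonexpansive hφ x y
  norm_num
  linarith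

theorem IsProx.norm_sub_le {φ : E → EReal} {R : E → E} (hφ : IsGammaZero φ)
    (hR : IsProx φ R) (x y : E) : ‖R x - R y‖ ≤ ‖x - y‖ := by
  have h := hR.firmly_nonexpansive hφ x y
  have h2 := real_inner_le_norm (R x - R y) (x - y)
  by_contra! hcon
  nlinarith [norm_nonneg (x - y)]

theorem IsActivation.map_zero {φ : E → EReal} {R : E → E} (h : IsActivation φ R) : R 0 = 0 := by
  have h1 := h.prox 0 (Set.mem_univ 0)
  have h2 := h.minimal_zero (R 0)
  have hp := h.prox.ne_top h.gammaZero 0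
  have h0 : φ 0 ≠ ⊤ := fun e => hp (top_le_iff.1 (e ▸ h2))
  simp only [Set.mem_ofPred_eq, zero_sub, norm_neg] at h1
  lift φ (R 0) to ℝ using ⟨hp, h.gammaZero.ne_bot _⟩ with a
  lift φ 0 to ℝ using ⟨h0, h.gammaZero.ne_bot _⟩ with b
  norm_cast at h1 h2
  have : ‖R 0‖ ^ 2 ≤ 0 := by
    simp at h1
    linarith
  simpa using this

theorem IsActivation.norm_le {φ : E → EReal} {R : E → E} (h : IsActivation φ R) (x : E) :
    ‖R x‖ ≤ ‖x‖ := by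
  simpa [h.map_zero] using h.prox.norm_sub_le h.gammaZero x 0

theorem IsActivation.continuous {φ : E → EReal} {R : E → E} (h : IsActivation φ R) :
    Continuous R :=
  (LipschitzWith.of_dist_le_mul (K := 1) fun x y => by
    simpa [dist_eq_norm] using h.prox.norm_sub_le h.gammaZero x y).continuous

theorem IsActivation.weakSeqContinuous_of_finiteDimensional [FiniteDimensional ℝ E]
    {φ : E → EReal} {R : E → E} (h : IsActivation φ R) : WeakSeqContinuous R := by
  have := FiniteDimensional.complete ℝ E
  intro y a hy
  have hs : Tendsto y atTop (𝓝 a) := by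
    let b := stdOrthonormalBasis ℝ E
    have : Tendsto (fun n => ∑ i, ⟪b i, y n⟫_ℝ • b i) atTop (𝓝 (∑ i, ⟪b i, a⟫_ℝ • b i)) :=
      tendsto_finsetSum _ fun i _ => Tendsto.smul_const
        (by simpa only [real_inner_comm] using hy.inner (b i)) _
    simpa only [b.sum_repr'] using this
  exact ((toWeakSpaceCLM ℝ E).continuous.tendsto _).comp ((h.continuous.tendsto a).comp hs)

/-- Each coordinate of `R` is a continuous function of the same coordinate of the argument, and `R`
preserves boundedness, so `R a` is the only weak cluster point. -/
theorem IsActivation.weakSeqContinuous_of_isSeparable [CompleteSpace E]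
    {φ : E → EReal} {R : E → E} (h : IsActivation φ R) (hs : IsSeparableActivation R) :
    WeakSeqContinuous R := by
  obtain ⟨K, e, ψ, r, hr, hsum⟩ := hs
  have hcoord : ∀ x k, ⟪R x, e k⟫_ℝ = r k ⟪x, e k⟫_ℝ := by
    intro x k
    have h1 := (innerSL ℝ (e k)).hasSum (hsum x)
    have h2 : HasSum (fun j => innerSL ℝ (e k) (r j ⟪x, e j⟫_ℝ • e j)) (r k ⟪x, e k⟫_ℝ) := by
      convert hasSum_ite_eq k (r k ⟪x, e k⟫_ℝ) using 2 with j
      simp only [innerSL_apply_apply, inner_smul_right, orthonormal_iff_ite.1 e.orthonormal]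
      by_cases hjk : j = k
      · subst hjk; simp
      · simp [hjk, Ne.symm hjk]
    rw [real_inner_comm]
    exact h1.unique h2
  intro y a hy
  obtain ⟨M, hM⟩ := hy.exists_norm_le
  have hRM : ∀ n, ‖R (y n)‖ ≤ M := fun n => (h.norm_le _).trans (hM n)
  have huniq : ∀ (U : Ultrafilter ℕ) (b : E), (U : Filter ℕ) ≤ atTop →
      (∀ v, Tendsto (fun n => ⟪R (y n), v⟫_ℝ) U (𝓝 ⟪b, v⟫_ℝ)) → b = R a := by
    intro U b hU hb
    refine e.repr.injective (lp.ext (funext fun k => ?_))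
    rw [e.repr_apply_apply, e.repr_apply_apply, real_inner_comm, real_inner_comm (R a)]
    refine tendsto_nhds_unique (hb (e k)) ?_
    have hc : Continuous (r k) := (LipschitzWith.of_dist_le_mul (K := 1) fun s t => by
      simpa [dist_eq_norm] using (hr k).2.2.2.norm_sub_le (hr k).1 s t).continuous
    simp only [hcoord]
    exact (hc.tendsto _).comp ((hy.inner (e k)).mono_left hU)
  obtain ⟨b, hb, U, hU, hbU⟩ := exists_weakLim_of_unique hRM fun U V b c hU hV hb hc =>
    (huniq U b hU hb).trans (huniq V c hV hc).symm
  rwa [huniq U b hU hbU] at hb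

end Hilbert

end ProxNet
namespace ProxNet

/-! ### Perturbed Krasnosel'skiĭ–Mann iterations -/

/-! ### Scalar recursions with summable perturbations -/

section RealSequences

theorem tendsto_of_le_add_summable {a e : ℕ → ℝ} (ha : ∀ n, 0 ≤ a n) (he : ∀ n, 0 ≤ e n)
    (hs : Summable e) (h : ∀ n, a (n + 1) ≤ a n + e n) : ∃ l, Tendsto a atTop (𝓝 l) := by
  have hanti : Antitone fun n => a n - ∑ k ∈ Finset.range n, e k :=
    antitone_nat_of_succ_le fun n => by
      rw [Finset.sum_range_succ]
      linarith [h n]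
  have hbdd : BddBelow (Set.range fun n => a n - ∑ k ∈ Finset.range n, e k) :=
    ⟨-∑' k, e k, by
      rintro _ ⟨n, rfl⟩
      linarith [ha n, hs.sum_le_tsum (Finset.range n) fun k _ => he k]⟩
  refine ⟨_, ((tendsto_atTop_ciInf hanti hbdd).add hs.hasSum.tendsto_sum_nat).congr fun n => ?_⟩
  ring

theorem exists_le_of_le_one_add_mul {a e : ℕ → ℝ} (ha : ∀ n, 0 ≤ a n) (he : ∀ n, 0 ≤ e n)
    (hs : Summable e) (h : ∀ n, a (n + 1) ≤ (1 + e n) * a n) : ∃ M, ∀ n, a n ≤ M := by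
  have key : ∀ n, a n ≤ Real.exp (∑ k ∈ Finset.range n, e k) * a 0 := by
    intro n
    induction n with
    | zero => simp
    | succ n ih =>
      have h1 : 1 + e n ≤ Real.exp (e n) := by linarith [Real.add_one_le_exp (e n)]
      rw [Finset.sum_range_succ, Real.exp_add]
      calc a (n + 1) ≤ (1 + e n) * a n := h n
        _ ≤ Real.exp (e n) * (Real.exp (∑ k ∈ Finset.range n, e k) * a 0) :=
          mul_le_mul h1 ih (ha n) (Real.exp_pos _).le
        _ = _ := by ring
  exact ⟨Real.exp (∑' k, e k) * a 0, fun n => (key n).trans (mul_le_mul_of_nonneg_right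
    (Real.exp_le_exp.2 (hs.sum_le_tsum _ fun k _ => he k)) (ha 0))⟩

/-- If l > 0, then eventually r > l/2, and the weighted sum would diverge with the sum of the
weights. -/
theorem tendsto_zero_of_sum_mul_sq_le {w r : ℕ → ℝ} {l C : ℝ} (hw : ∀ n, 0 ≤ w n)
    (hr : ∀ n, 0 ≤ r n) (hl : Tendsto r atTop (𝓝 l))
    (hC : ∀ n, ∑ k ∈ Finset.range n, w k * r k ^ 2 ≤ C)
    (hdiv : Tendsto (fun n => ∑ k ∈ Finset.range n, w k) atTop atTop) :
    Tendsto r atTop (𝓝 0) := by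
  rcases (ge_of_tendsto' hl hr).eq_or_lt with h0 | h0
  · rwa [h0]
  exfalso
  obtain ⟨n₀, hn₀⟩ := eventually_atTop.1 (hl.eventually (lt_mem_nhds (half_lt_self h0)))
  have hlow : ∀ n, n₀ ≤ n → (l / 2) ^ 2 *
      (∑ k ∈ Finset.range n, w k - ∑ k ∈ Finset.range n₀, w k) ≤ C := by
    intro n hn
    refine le_trans ?_ (hC n)
    rw [← Finset.sum_range_add_sum_Ico _ hn, add_sub_cancel_left,
      ← Finset.sum_range_add_sum_Ico (fun k => w k * r k ^ 2) hn, Finset.mul_sum]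
    refine le_add_of_nonneg_of_le
      (Finset.sum_nonneg fun k _ => mul_nonneg (hw k) (sq_nonneg _)) (Finset.sum_le_sum ?_)
    intro k hk
    rw [mul_comm]
    exact mul_le_mul_of_nonneg_left (pow_le_pow_left₀ (by positivity)
      (hn₀ k (Finset.mem_Ico.1 hk).1).le 2) (hw k)
  have hq : 0 < (l / 2) ^ 2 := by positivity
  obtain ⟨n, hn, hn'⟩ := ((hdiv.eventually_gt_atTop
    (C / (l / 2) ^ 2 + ∑ k ∈ Finset.range n₀, w k)).and (eventually_ge_atTop n₀)).exists
  have h1 := hlow n hn'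
  have h2 : C / (l / 2) ^ 2 * (l / 2) ^ 2 = C := div_mul_cancel₀ _ hq.ne'
  nlinarith

end RealSequences

section KrasnoselskiiMann

variable {E : Type u} [NormedAddCommGroup E] [InnerProductSpace ℝ E]

theorem norm_sq_combo (t : ℝ) (u v : E) :
    ‖(1 - t) • u + t • v‖ ^ 2
      = (1 - t) * ‖u‖ ^ 2 + t * ‖v‖ ^ 2 - t * (1 - t) * ‖v - u‖ ^ 2 := by
  rw [norm_add_sq_real, norm_sub_sq_real, norm_smul, norm_smul, inner_smul_left, inner_smul_right,
    mul_pow, mul_pow, Real.norm_eq_abs, Real.norm_eq_abs, sq_abs, sq_abs, real_inner_comm]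
  simp only [conj_trivial]
  ring

/-- Demiclosedness of `Id - Q` at zero, along an ultrafilter. -/
theorem eq_of_tendsto_inner_of_residual {Q : E → E} (hQ : ∀ x y, ‖Q x - Q y‖ ≤ ‖x - y‖)
    {x : ℕ → E} {a : E} {M : ℝ} (hM : ∀ n, ‖x n‖ ≤ M) {U : Ultrafilter ℕ}
    (ha : ∀ v, Tendsto (fun n => ⟪x n, v⟫_ℝ) U (𝓝 ⟪a, v⟫_ℝ))
    (hr : Tendsto (fun n => ‖Q (x n) - x n‖) U (𝓝 0)) : Q a = a := by
  -- ‖x_n - Qa‖² is bounded through nonexpansiveness and also expanded around a; comparing the two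
  -- leaves a right-hand side that tends to 0.
  have hle : ∀ n, ‖a - Q a‖ ^ 2 ≤ ‖Q (x n) - x n‖ * (‖Q (x n) - x n‖ + 2 * (M + ‖a‖))
      - 2 * (⟪x n, a - Q a⟫_ℝ - ⟪a, a - Q a⟫_ℝ) := by
    intro n
    have h1 : ‖x n - Q a‖ ≤ ‖Q (x n) - x n‖ + ‖x n - a‖ := by
      calc ‖x n - Q a‖ = ‖(Q (x n) - Q a) - (Q (x n) - x n)‖ := by congr 1; abel
        _ ≤ _ := (norm_sub_le _ _).trans (by linarith [hQ (x n) a])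
    have h2 : ‖x n - Q a‖ ^ 2 = ‖x n - a‖ ^ 2 + 2 * (⟪x n, a - Q a⟫_ℝ - ⟪a, a - Q a⟫_ℝ)
        + ‖a - Q a‖ ^ 2 := by
      rw [← inner_sub_left, ← norm_add_sq_real]
      congr 2; abel
    have h3 : ‖x n - a‖ ≤ M + ‖a‖ := (norm_sub_le _ _).trans (by linarith [hM n])
    have h4 := pow_le_pow_left₀ (norm_nonneg _) h1 2
    nlinarith [norm_nonneg (Q (x n) - x n)]
  have hlim : Tendsto (fun n => ‖Q (x n) - x n‖ * (‖Q (x n) - x n‖ + 2 * (M + ‖a‖))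
      - 2 * (⟪x n, a - Q a⟫_ℝ - ⟪a, a - Q a⟫_ℝ)) U (𝓝 0) := by
    have := (hr.mul (hr.add_const (2 * (M + ‖a‖)))).sub
      (((ha (a - Q a)).sub_const ⟪a, a - Q a⟫_ℝ).const_mul 2)
    simpa using this
  have h0 := ge_of_tendsto' hlim hle
  have : ‖a - Q a‖ = 0 := by nlinarith [norm_nonneg (a - Q a)]
  exact (sub_eq_zero.1 (norm_eq_zero.1 this)).symm

/-- Opial's lemma for a nonexpansive operator. -/
theorem exists_weakLim_fixedPoint [CompleteSpace E] {Q : E → E}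
    (hQ : ∀ x y, ‖Q x - Q y‖ ≤ ‖x - y‖) {x : ℕ → E} {M : ℝ} (hM : ∀ n, ‖x n‖ ≤ M)
    (hF : ∀ z, Q z = z → ∃ l, Tendsto (fun n => ‖x n - z‖) atTop (𝓝 l))
    (hr : Tendsto (fun n => ‖Q (x n) - x n‖) atTop (𝓝 0)) : ∃ a, Q a = a ∧ WeakLim x a := by
  have hfix : ∀ (U : Ultrafilter ℕ) (a : E), (U : Filter ℕ) ≤ atTop →
      (∀ v, Tendsto (fun n => ⟪x n, v⟫_ℝ) U (𝓝 ⟪a, v⟫_ℝ)) → Q a = a := fun U a hU ha =>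
    eq_of_tendsto_inner_of_residual hQ hM ha (hr.mono_left hU)
  obtain ⟨a, ha, U, hU, haU⟩ := exists_weakLim_of_unique hM fun U V a b hU hV ha hb => by
    obtain ⟨la, hla⟩ := hF a (hfix U a hU ha)
    obtain ⟨lb, hlb⟩ := hF b (hfix V b hV hb)
    -- By polarization, convergence of the distances to a and to b forces this inner product to
    -- converge along the whole sequence, so its limits at a and at b agree.
    have hlim : Tendsto (fun n => ⟪x n, a - b⟫_ℝ) atTop
        (𝓝 ((lb ^ 2 - la ^ 2 + ‖a‖ ^ 2 - ‖b‖ ^ 2) / 2)) := by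
      refine (((((hlb.pow 2).sub (hla.pow 2)).add_const (‖a‖ ^ 2)).sub_const
        (‖b‖ ^ 2)).div_const 2).congr fun n => ?_
      rw [norm_sub_sq_real, norm_sub_sq_real, inner_sub_right]
      ring
    have h1 := tendsto_nhds_unique (ha (a - b)) (hlim.mono_left hU)
    have h2 := tendsto_nhds_unique (hb (a - b)) (hlim.mono_left hV)
    have h3 : ⟪a - b, a - b⟫_ℝ = 0 := by rw [inner_sub_left, h1, h2, sub_self]
    exact sub_eq_zero.1 (inner_self_eq_zero.1 h3)
  exact ⟨a, hfix U a hU haU, ha⟩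

/-- One relaxed step of a nonexpansive operator, followed by a perturbation. -/
theorem norm_relaxed_step_sub_le {Q : E → E} (hQ : ∀ x y, ‖Q x - Q y‖ ≤ ‖x - y‖) {z : E}
    (hz : Q z = z) {t : ℝ} (ht : t ∈ Set.Icc (0 : ℝ) 1) (x : E) :
    ‖x + t • (Q x - x) - z‖ ^ 2 ≤ ‖x - z‖ ^ 2 - t * (1 - t) * ‖Q x - x‖ ^ 2 := by
  have e1 : x + t • (Q x - x) - z = (1 - t) • (x - z) + t • (Q x - z) := by module
  have e2 : Q x - z - (x - z) = Q x - x := by abel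
  rw [e1, norm_sq_combo, e2]
  have h1 : ‖Q x - z‖ ≤ ‖x - z‖ := by simpa [hz] using hQ x z
  nlinarith [pow_le_pow_left₀ (norm_nonneg _) h1 2, ht.1]

/-- Almost monotone residuals converge; without this, divergence of the weights would only give a
vanishing lower limit. -/
theorem norm_relaxed_step_residual_le {Q : E → E} (hQ : ∀ x y, ‖Q x - Q y‖ ≤ ‖x - y‖)
    {t : ℝ} (ht : t ∈ Set.Icc (0 : ℝ) 1) (x e : E) :
    ‖Q (x + t • (Q x - x) + e) - (x + t • (Q x - x) + e)‖ ≤ ‖Q x - x‖ + 2 * ‖e‖ := by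
  set y := x + t • (Q x - x)
  have h1 : ‖Q (y + e) - Q y‖ ≤ ‖e‖ := by simpa using hQ (y + e) y
  have h2 : ‖Q y - Q x‖ ≤ t * ‖Q x - x‖ := by
    refine (hQ y x).trans_eq ?_
    rw [show y - x = t • (Q x - x) by simp [y], norm_smul, Real.norm_of_nonneg ht.1]
  have h3 : ‖Q x - y‖ = (1 - t) * ‖Q x - x‖ := by
    rw [show Q x - y = (1 - t) • (Q x - x) by simp only [y]; module, norm_smul,
      Real.norm_of_nonneg (sub_nonneg.2 ht.2)]
  have e1 : Q (y + e) - (y + e) = (Q (y + e) - Q y) + ((Q y - Q x) + (Q x - y)) - e := by abel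
  rw [e1]
  have h4 := norm_sub_le ((Q (y + e) - Q y) + ((Q y - Q x) + (Q x - y))) e
  have h5 := norm_add_le (Q (y + e) - Q y) ((Q y - Q x) + (Q x - y))
  have h6 := norm_add_le (Q y - Q x) (Q x - y)
  linarith

/-- Krasnosel'skiĭ–Mann iterations with summable errors that may grow linearly with the
iterates. -/
theorem krasnoselskii_mann [CompleteSpace E] {Q : E → E} (hQ : ∀ x y, ‖Q x - Q y‖ ≤ ‖x - y‖)
    {z : E} (hz : Q z = z) {t : ℕ → ℝ} (ht : ∀ n, t n ∈ Set.Icc (0 : ℝ) 1) {x e : ℕ → E}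
    (hx : ∀ n, x (n + 1) = x n + t n • (Q (x n) - x n) + e n) {δ : ℕ → ℝ} (hδ0 : ∀ n, 0 ≤ δ n)
    (hδ : Summable δ) (he : ∀ n, ‖e n‖ ≤ δ n * (‖x n‖ + 1))
    (hc : Tendsto (fun n => ‖Q (x n) - x n‖) atTop (𝓝 0) ∨
      Tendsto (fun n => ∑ k ∈ Finset.range n, t k * (1 - t k)) atTop atTop) :
    ∃ a, Q a = a ∧ WeakLim x a ∧ Tendsto (fun n => ‖Q (x n) - x n‖) atTop (𝓝 0) ∧
      ∃ M, ∀ n, ‖x n‖ ≤ M := by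
  have hstep : ∀ z, Q z = z → ∀ n, ‖x n + t n • (Q (x n) - x n) - z‖ ≤ ‖x n - z‖ := by
    intro z hz n
    refine le_of_sq_le_sq ((norm_relaxed_step_sub_le hQ hz (ht n) (x n)).trans ?_) (norm_nonneg _)
    exact sub_le_self _ (mul_nonneg (mul_nonneg (ht n).1 (sub_nonneg.2 (ht n).2)) (sq_nonneg _))
  have hfejer : ∀ z, Q z = z → ∀ n, ‖x (n + 1) - z‖ ≤ ‖x n - z‖ + ‖e n‖ := by
    intro z hz n
    rw [hx n, add_sub_right_comm]
    exact (norm_add_le _ _).trans (by linarith [hstep z hz n])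
  -- The errors are not known to be summable until the iterates are bounded. The shift ‖z‖ + 1
  -- dominates the ‖x_n‖ + 1 in the error and makes the recursion purely multiplicative.
  obtain ⟨B, hB⟩ := exists_le_of_le_one_add_mul (a := fun n => ‖x n - z‖ + (‖z‖ + 1))
    (fun n => by positivity) hδ0 hδ fun n => by
      have h1 : ‖x n‖ ≤ ‖x n - z‖ + ‖z‖ := norm_le_norm_sub_add _ _
      nlinarith [hfejer z hz n, he n, mul_le_mul_of_nonneg_left h1 (hδ0 n)]
  have hM : ∀ n, ‖x n‖ ≤ B := fun n => by
    linarith [hB n, norm_le_norm_sub_add (x n) z]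
  have hes : Summable fun n => ‖e n‖ :=
    Summable.of_nonneg_of_le (fun n => norm_nonneg _)
      (fun n => (he n).trans (mul_le_mul_of_nonneg_left (add_le_add_left (hM n) 1) (hδ0 n)))
      (hδ.mul_right (B + 1))
  have hF : ∀ z, Q z = z → ∃ l, Tendsto (fun n => ‖x n - z‖) atTop (𝓝 l) := fun z hz =>
    tendsto_of_le_add_summable (fun n => norm_nonneg _) (fun n => norm_nonneg _) hes (hfejer z hz)
  have hr : Tendsto (fun n => ‖Q (x n) - x n‖) atTop (𝓝 0) := by
    rcases hc with hc | hc
    · exact hc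
    obtain ⟨l, hl⟩ := tendsto_of_le_add_summable (a := fun n => ‖Q (x n) - x n‖)
      (fun n => norm_nonneg _) (fun n => by positivity) (hes.mul_left 2) fun n => by
        rw [hx n]
        exact norm_relaxed_step_residual_le hQ (ht n) _ _
    obtain ⟨D, hD⟩ := hes.tendsto_atTop_zero.bddAbove_range
    have hD : ∀ n, ‖e n‖ ≤ D := fun n => hD ⟨n, rfl⟩
    have hdec : ∀ n, t n * (1 - t n) * ‖Q (x n) - x n‖ ^ 2 ≤
        ‖x n - z‖ ^ 2 - ‖x (n + 1) - z‖ ^ 2 + ‖e n‖ * (2 * B + D) := by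
      intro n
      have h1 := norm_relaxed_step_sub_le hQ hz (ht n) (x n)
      have h2 := hstep z hz n
      have h3 : ‖x n - z‖ ≤ B := by linarith [hB n, norm_nonneg z]
      have h4 : ‖x (n + 1) - z‖ ≤ ‖x n + t n • (Q (x n) - x n) - z‖ + ‖e n‖ := by
        rw [hx n, add_sub_right_comm]
        exact norm_add_le _ _
      have h5 := pow_le_pow_left₀ (norm_nonneg _) h4 2
      nlinarith [hD n, norm_nonneg (e n)]
    refine tendsto_zero_of_sum_mul_sq_le (C := ‖x 0 - z‖ ^ 2 + (∑' n, ‖e n‖) * (2 * B + D))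
      (fun n => mul_nonneg (ht n).1 (sub_nonneg.2 (ht n).2)) (fun n => norm_nonneg _) hl ?_ hc
    intro n
    have hB0 : 0 ≤ 2 * B + D := by
      linarith [hD 0, norm_nonneg (e 0), hM 0, norm_nonneg (x 0)]
    have h1 := Finset.sum_le_sum fun k (_ : k ∈ Finset.range n) => hdec k
    rw [Finset.sum_add_distrib, Finset.sum_range_sub' (fun k => ‖x k - z‖ ^ 2),
      ← Finset.sum_mul] at h1
    have h2 := mul_le_mul_of_nonneg_right
      (hes.sum_le_tsum (Finset.range n) fun k _ => norm_nonneg _) hB0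
    linarith [sq_nonneg ‖x n - z‖]
  obtain ⟨a, ha, haw⟩ := exists_weakLim_fixedPoint hQ hM hF hr
  exact ⟨a, ha, haw, hr, B, hM⟩

end KrasnoselskiiMann

end ProxNet
namespace ProxNet

section Networks

variable {m : ℕ} {H : Fin (m + 1) → Type u} [∀ i, NormedAddCommGroup (H i)]
  [∀ i, InnerProductSpace ℝ (H i)]

theorem Layers.output_zero (N : Layers H) (x : H 0) : N.output 0 x = x := rfl

theorem Layers.output_succ (N : Layers H) (i : Fin m) (x : H 0) :
    N.output i.succ x = N.R i (N.W i (N.output i.castSucc x) + N.b i) := by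
  simp [Layers.output, Layers.layer]

/-! ### Averagedness of the network -/

theorem layerSum_succ (W : ∀ i : Fin m, H i.castSucc →L[ℝ] H i.succ) (i : Fin m) (v : ∀ i, H i) :
    layerSum W i.succ v = W i (layerSum W i.castSucc v + v i.castSucc) := by
  have hI : (Finset.Iio i.succ : Finset (Fin (m + 1))) =
      insert i.castSucc (Finset.Iio i.castSucc) := by
    ext k
    simp only [Finset.mem_Iio, Finset.mem_insert, Fin.lt_def, Fin.ext_iff, Fin.val_succ,
      Fin.val_castSucc]
    omega
  rw [layerSum, hI, Finset.sum_insert (by simp), weightComp_succ W _ i le_rfl, weightComp_self,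
    add_comm, map_add, layerSum, map_sum]
  congr 1
  refine Finset.sum_congr rfl fun k hk => ?_
  rw [weightComp_succ W k i (Finset.mem_Iio.1 hk).le]
  rfl

theorem layerSum_zero (W : ∀ i : Fin m, H i.castSucc →L[ℝ] H i.succ) (v : ∀ i, H i) :
    layerSum W 0 v = 0 := by
  rw [layerSum, Finset.sum_eq_zero]
  intro k hk
  exact absurd (Finset.mem_Iio.1 hk) (by simp)

theorem layerSum_smul (W : ∀ i : Fin m, H i.castSucc →L[ℝ] H i.succ) (i : Fin (m + 1)) (c : ℝ)
    (v : ∀ i, H i) : layerSum W i (fun k => c • v k) = c • layerSum W i v := by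
  simp [layerSum, Finset.smul_sum]

/-- The averagedness condition without the normalization of the first component. -/
theorem AveragedCondition.norm_le {J : H (Fin.last m) ≃ₗᵢ[ℝ] H 0}
    {W : ∀ i : Fin m, H i.castSucc →L[ℝ] H i.succ} {α : ℝ} (h : AveragedCondition J W α)
    (v : ∀ i, H i)
    (hv : ∀ i : Fin (m + 1), 0 < i → i < Fin.last m → ‖v i‖ ≤ ‖layerSum W i v‖) :
    ‖J (layerSum W (Fin.last m) v) - ((2 : ℝ) ^ m * (1 - α)) • v 0‖
      + ‖J (layerSum W (Fin.last m) v)‖ ≤ (2 : ℝ) ^ m * α * ‖v 0‖ := by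
  -- The extra 1 covers the case `v 0 = 0`.
  set c := (‖v 0‖ + 1)⁻¹ with hc
  have hc0 : 0 < c := by positivity
  have key := h (fun i => c • v i) ?_ ?_
  · rw [layerSum_smul, map_smul, smul_comm _ c, ← smul_sub, norm_smul, norm_smul, norm_smul,
      Real.norm_of_nonneg hc0.le] at key
    refine le_of_mul_le_mul_left ?_ hc0
    linarith
  · rw [norm_smul, Real.norm_of_nonneg hc0.le, hc, inv_mul_le_one₀ (by positivity)]
    linarith
  · intro i hi hi'
    rw [layerSum_smul, norm_smul, norm_smul]
    exact mul_le_mul_of_nonneg_left (hv i hi hi') (norm_nonneg _)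

theorem Layers.norm_two_smul_output_sub_le {N : Layers H} {φ : ∀ i : Fin m, H i.succ → EReal}
    (hR : ∀ i, IsActivation (φ i) (N.R i)) (i : Fin m) (x y : H 0) :
    ‖(2 : ℝ) • (N.output i.succ x - N.output i.succ y)
        - N.W i (N.output i.castSucc x - N.output i.castSucc y)‖
      ≤ ‖N.W i (N.output i.castSucc x - N.output i.castSucc y)‖ := by
  rw [N.output_succ, N.output_succ, map_sub]
  simpa using (hR i).prox.norm_two_smul_sub_le (hR i).gammaZero
    (N.W i (N.output i.castSucc x) + N.b i) (N.W i (N.output i.castSucc y) + N.b i)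

/-- The powers of 2 absorb the factor 1/2 in R = (Id + (2R - Id))/2 at each layer, so that the
scaled differences expand without fractions. -/
theorem Layers.comp_averaged {N : Layers H} {φ : ∀ i : Fin m, H i.succ → EReal}
    (hR : ∀ i, IsActivation (φ i) (N.R i)) {J : H (Fin.last m) ≃ₗᵢ[ℝ] H 0} {α : ℝ} (hm : 1 ≤ m)
    (hb : AveragedCondition J N.W α) (x y : H 0) :
    ‖N.comp J x - N.comp J y - (1 - α) • (x - y)‖ ≤ α * ‖x - y‖ := by
  let a : ∀ i, H i := fun i => (2 : ℝ) ^ (i : ℕ) • (N.output i x - N.output i y)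
  let v : ∀ i, H i := Fin.cases (x - y) fun i => a i.succ - N.W i (a i.castSucc)
  have hv0 : v 0 = x - y := rfl
  have hvs : ∀ i : Fin m, v i.succ = a i.succ - N.W i (a i.castSucc) := fun i => rfl
  have hsum : ∀ i, a i = layerSum N.W i v + v i := by
    intro i
    induction i using Fin.induction with
    | zero => simp [layerSum_zero, hv0, a, Layers.output_zero]
    | succ i ih => rw [layerSum_succ, ← ih, hvs]; abel
  have hvle : ∀ i : Fin m, ‖v i.succ‖ ≤ ‖layerSum N.W i.succ v‖ := by
    intro i
    rw [layerSum_succ, ← hsum, hvs]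
    have e : a i.succ - N.W i (a i.castSucc) = (2 : ℝ) ^ (i : ℕ) •
        ((2 : ℝ) • (N.output i.succ x - N.output i.succ y)
          - N.W i (N.output i.castSucc x - N.output i.castSucc y)) := by
      simp only [a, map_smul, Fin.val_succ, Fin.val_castSucc, pow_succ]
      module
    rw [e]
    simp only [a, map_smul, Fin.val_castSucc, norm_smul]
    exact mul_le_mul_of_nonneg_left (N.norm_two_smul_output_sub_le hR i x y) (norm_nonneg _)
  have hvle' : ∀ i : Fin (m + 1), 0 < i → ‖v i‖ ≤ ‖layerSum N.W i v‖ := by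
    intro i hi
    obtain ⟨j, rfl⟩ := Fin.exists_succ_eq.2 hi.ne'
    exact hvle j
  have key := hb.norm_le v fun i hi _ => hvle' i hi
  -- The last component is not an argument of condition (b); its bound by ‖L_m v‖ matches the second
  -- summand there.
  have hlast := hvle' (Fin.last m) (Fin.lt_def.2 (by simp only [Fin.val_zero, Fin.val_last]; omega))
  have h2 : (0 : ℝ) < 2 ^ m := by positivity
  have e : (2 : ℝ) ^ m • (N.comp J x - N.comp J y - (1 - α) • (x - y)) =
      (J (layerSum N.W (Fin.last m) v) - ((2 : ℝ) ^ m * (1 - α)) • v 0) + J (v (Fin.last m)) := by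
    rw [sub_add_eq_add_sub, ← map_add, ← hsum, hv0]
    simp only [a, Layers.comp, Fin.val_last, map_smul, map_sub]
    module
  refine le_of_mul_le_mul_left ?_ h2
  calc (2 : ℝ) ^ m * ‖N.comp J x - N.comp J y - (1 - α) • (x - y)‖
      = ‖(2 : ℝ) ^ m • (N.comp J x - N.comp J y - (1 - α) • (x - y))‖ := by
        rw [norm_smul, Real.norm_of_nonneg h2.le]
    _ ≤ ‖J (layerSum N.W (Fin.last m) v) - ((2 : ℝ) ^ m * (1 - α)) • v 0‖
        + ‖J (v (Fin.last m))‖ := by rw [e]; exact norm_add_le _ _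
    _ ≤ 2 ^ m * (α * ‖x - y‖) := by
        rw [J.norm_map (v (Fin.last m))]
        rw [J.norm_map, hv0] at key
        rw [hv0]
        linarith

/-! ### Perturbation of the layers -/

theorem Layers.norm_output_le {N : Layers H} {φ : ∀ i : Fin m, H i.succ → EReal}
    (hR : ∀ i, IsActivation (φ i) (N.R i)) (i : Fin (m + 1)) :
    ∃ C, 0 ≤ C ∧ ∀ x, ‖N.output i x‖ ≤ C * (‖x‖ + 1) := by
  induction i using Fin.induction with
  | zero => exact ⟨1, zero_le_one, fun x => by rw [N.output_zero]; linarith⟩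
  | succ i ih =>
    obtain ⟨C, hC0, hC⟩ := ih
    refine ⟨‖N.W i‖ * C + ‖N.b i‖, by positivity, fun x => ?_⟩
    rw [N.output_succ]
    calc _ ≤ ‖N.W i (N.output i.castSucc x) + N.b i‖ := (hR i).norm_le _
      _ ≤ ‖N.W i‖ * (C * (‖x‖ + 1)) + ‖N.b i‖ := (norm_add_le _ _).trans
          (add_le_add_left ((N.W i).le_opNorm_of_le (hC x)) _)
      _ ≤ _ := by nlinarith [norm_nonneg x, norm_nonneg (N.b i)]

theorem SummablyClose.exists_uniform {N : ℕ → Layers H} {N' : Layers H}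
    (h : SummablyClose N N') : ∃ δ : ℕ → ℝ, IsEllOnePos δ ∧ ∀ i : Fin m, ∀ n,
      ‖(N n).W i - N'.W i‖ ≤ δ n ∧ (∀ x, ‖(N n).R i x - N'.R i x‖ ≤ δ n * ‖x‖ + δ n) ∧
        ‖(N n).b i - N'.b i‖ ≤ δ n := by
  obtain ⟨ω, ρ, η, ν, ⟨hω, hω'⟩, ⟨hρ, hρ'⟩, ⟨hη, hη'⟩, ⟨hν, hν'⟩, hN⟩ := h
  refine ⟨fun n => ω n + ρ n + η n + ν n, ⟨fun n => ?_, ((hω'.add hρ').add hη').add hν'⟩,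
    fun i n => ⟨?_, fun x => ?_, ?_⟩⟩
  · linarith [hω n, hρ n, hη n, hν n]
  · linarith [(hN i).1 n, hρ n, hη n, hν n]
  · have h1 : ρ n ≤ ω n + ρ n + η n + ν n := by linarith [hω n, hη n, hν n]
    have h2 := mul_le_mul_of_nonneg_right h1 (norm_nonneg x)
    linarith [(hN i).2.1 n x, hω n, hρ n, hν n]
  · linarith [(hN i).2.2 n, hω n, hρ n, hη n]

/-- The limit activation at the perturbed argument is inserted: one difference is the activation
error, and the other is controlled by nonexpansiveness and the error of the previous layer. -/
theorem Layers.norm_output_sub_le {N : ℕ → Layers H} {N' : Layers H}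
    {φ : ∀ i : Fin m, H i.succ → EReal} (hR : ∀ i, IsActivation (φ i) (N'.R i))
    {δ : ℕ → ℝ} (hδ : IsEllOnePos δ) (hN : ∀ i : Fin m, ∀ n,
      ‖(N n).W i - N'.W i‖ ≤ δ n ∧ (∀ x, ‖(N n).R i x - N'.R i x‖ ≤ δ n * ‖x‖ + δ n) ∧
        ‖(N n).b i - N'.b i‖ ≤ δ n) (i : Fin (m + 1)) :
    ∃ K, 0 ≤ K ∧ ∀ n x, ‖(N n).output i x - N'.output i x‖ ≤ δ n * K * (‖x‖ + 1) := by
  obtain ⟨D, hD⟩ := hδ.2.tendsto_atTop_zero.bddAbove_range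
  have hD : ∀ n, δ n ≤ D := fun n => hD ⟨n, rfl⟩
  have hD0 : 0 ≤ D := (hδ.1 0).trans (hD 0)
  induction i using Fin.induction with
  | zero => exact ⟨0, le_rfl, fun n x => by simp [Layers.output_zero]⟩
  | succ i ih =>
    obtain ⟨K, hK0, hK⟩ := ih
    obtain ⟨C, hC0, hC⟩ := N'.norm_output_le hR i.castSucc
    set w := ‖N'.W i‖
    set β := ‖N'.b i‖
    have hw : 0 ≤ w := norm_nonneg _
    have hβ : 0 ≤ β := norm_nonneg _
    set G := C + D * K
    have hG : 0 ≤ G := by positivity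
    -- The summands come, in order, from the activation error (its linear and constant parts), the
    -- weight error, the propagated error and the bias error.
    refine ⟨((w + D) * G + (β + D)) + 1 + G + w * K + 1, by positivity, fun n x => ?_⟩
    obtain ⟨hW, hRn, hbn⟩ := hN i n
    rw [(N n).output_succ, N'.output_succ]
    have hd := hK n x
    have hy := hC x
    set y' := (N n).output i.castSucc x
    set y := N'.output i.castSucc x
    set s := ‖x‖ + 1
    have hs : 1 ≤ s := le_add_of_nonneg_left (norm_nonneg x)
    have hδ0 := hδ.1 n
    have hδD := hD n
    have hy' : ‖y'‖ ≤ G * s := by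
      have h1 := norm_le_norm_sub_add y' y
      have h2 : δ n * K * s ≤ D * K * s := by gcongr
      simp only [G]
      linarith
    have hWn : ‖(N n).W i‖ ≤ w + D := by
      have := norm_le_norm_sub_add ((N n).W i) (N'.W i)
      linarith
    have hbn' : ‖(N n).b i‖ ≤ β + D := by
      have := norm_le_norm_sub_add ((N n).b i) (N'.b i)
      linarith
    have harg : ‖(N n).W i y' + (N n).b i‖ ≤ ((w + D) * G + (β + D)) * s := by
      refine (norm_add_le _ _).trans ?_
      have h1 := ((N n).W i).le_of_opNorm_le_of_le hWn hy'
      nlinarith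
    have h1 : ‖(N n).R i ((N n).W i y' + (N n).b i) - N'.R i ((N n).W i y' + (N n).b i)‖ ≤
        δ n * (((w + D) * G + (β + D)) * s) + δ n :=
      (hRn _).trans (by gcongr)
    have h2 : ‖N'.R i ((N n).W i y' + (N n).b i) - N'.R i (N'.W i y + N'.b i)‖ ≤
        δ n * (G * s) + w * (δ n * K * s) + δ n := by
      refine ((hR i).prox.norm_sub_le (hR i).gammaZero _ _).trans ?_
      have e : (N n).W i y' + (N n).b i - (N'.W i y + N'.b i) =
          ((N n).W i - N'.W i) y' + N'.W i (y' - y) + ((N n).b i - N'.b i) := by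
        simp only [sub_apply, map_sub]
        abel
      rw [e]
      exact (norm_add₃_le).trans (add_le_add (add_le_add
        (ContinuousLinearMap.le_of_opNorm_le_of_le _ hW hy')
        (ContinuousLinearMap.le_of_opNorm_le_of_le _ le_rfl hd)) hbn)
    have h3 := norm_sub_le_norm_sub_add_norm_sub ((N n).R i ((N n).W i y' + (N n).b i))
      (N'.R i ((N n).W i y' + (N n).b i)) (N'.R i (N'.W i y + N'.b i))
    have h4 : δ n ≤ δ n * s := le_mul_of_one_le_right hδ0 hs
    linarith

/-! ### The variational inequality -/

theorem Layers.solvesVI {N : Layers H} {φ : ∀ i : Fin m, H i.succ → EReal}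
    (hR : ∀ i, IsActivation (φ i) (N.R i)) {J : H (Fin.last m) ≃ₗᵢ[ℝ] H 0} {x : H 0}
    (hx : N.comp J x = x) : SolvesVI J N φ fun i => N.output i x := by
  refine ⟨hx.symm, fun i => ⟨N.W i (N.output i.castSucc x) + N.b i - N.output i.succ x, ?_, ?_⟩⟩
  · rw [N.output_succ]
    exact (hR i).prox.sub_mem_subdifferential (hR i).gammaZero _
  · abel

/-! ### Weak convergence of the layer outputs -/

theorem Layers.weakLim_output [∀ i, CompleteSpace (H i)] {N : Layers H} {x : ℕ → H 0} {a : H 0}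
    (hx : WeakLim x a) (hR : ∀ i : Fin m, i.succ ≠ Fin.last m → WeakSeqContinuous (N.R i))
    (i : Fin (m + 1)) (hi : i ≠ Fin.last m) :
    WeakLim (fun n => N.output i (x n)) (N.output i a) := by
  induction i using Fin.induction with
  | zero => exact hx
  | succ i ih =>
    simp only [N.output_succ]
    exact hR i hi _ _ (((ih (Fin.castSucc_lt_last i).ne).map (N.W i)).add_tendsto
      tendsto_const_nhds)

/-- A layer whose weight operator satisfies the one-layer averagedness condition with respect to
the isometry `A` is averaged. -/
theorem norm_sq_le_of_layerwise {E F : Type u} [NormedAddCommGroup E] [InnerProductSpace ℝ E]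
    [NormedAddCommGroup F] [InnerProductSpace ℝ F] {W : E →L[ℝ] F} (A : E ≃ₗᵢ[ℝ] F) {β : ℝ}
    (hW : ‖W - (2 * (1 - β)) • (A : E →L[ℝ] F)‖ + ‖W‖ ≤ 2 * β) {d : E} {d' : F}
    (hd : ‖(2 : ℝ) • d' - W d‖ ≤ ‖W d‖) :
    (1 - β) * ‖d' - A d‖ ^ 2 ≤ β * (‖d‖ ^ 2 - ‖d'‖ ^ 2) := by
  have h1 : ‖(2 : ℝ) • (d' - (1 - β) • A d)‖ ≤ 2 * β * ‖d‖ := by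
    have e : (2 : ℝ) • (d' - (1 - β) • A d) =
        ((2 : ℝ) • d' - W d) + (W - (2 * (1 - β)) • (A : E →L[ℝ] F)) d := by
      have : (W - (2 * (1 - β)) • (A : E →L[ℝ] F)) d = W d - (2 * (1 - β)) • A d := rfl
      rw [this]
      module
    rw [e]
    refine (norm_add_le _ _).trans ?_
    have h2 := (W - (2 * (1 - β)) • (A : E →L[ℝ] F)).le_opNorm d
    have h3 := W.le_opNorm d
    nlinarith [mul_le_mul_of_nonneg_right hW (norm_nonneg d)]
  rw [norm_smul, Real.norm_of_nonneg zero_le_two, mul_assoc] at h1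
  -- Expanding the square of ‖d' - (1-β)Ad‖ ≤ β‖d‖ gives exactly the claimed inequality, since A
  -- preserves norms.
  have h2 := pow_le_pow_left₀ (norm_nonneg _) (le_of_mul_le_mul_left h1 zero_lt_two) 2
  rw [norm_sub_sq_real, norm_smul, inner_smul_right, mul_pow, mul_pow, Real.norm_eq_abs, sq_abs,
    A.norm_map] at h2
  rw [norm_sub_sq_real, A.norm_map]
  nlinarith

/-- Norms of the differences decrease through the layers, so the drop at each layer is at most the
total drop, which vanishes; averagedness of the layer bounds its displacement by that drop. -/
theorem Layers.tendsto_output_sub_of_layerwise {N : Layers H}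
    {φ : ∀ i : Fin m, H i.succ → EReal} (hR : ∀ i, IsActivation (φ i) (N.R i))
    (e : ∀ i, H i ≃ₗᵢ[ℝ] H 0) (he0 : e 0 = LinearIsometryEquiv.refl ℝ (H 0))
    (hW : ∀ i : Fin m, ∃ β : ℝ, 0 < β ∧ β < 1 ∧
      ‖N.W i - (2 * (1 - β)) •
          (((e i.castSucc).trans (e i.succ).symm : H i.castSucc ≃ₗᵢ[ℝ] H i.succ) :
            H i.castSucc →L[ℝ] H i.succ)‖ + ‖N.W i‖ ≤ 2 * β)
    {x : ℕ → H 0} {a : H 0} (hx : Tendsto (fun n => ‖x n - a‖ ^ 2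
      - ‖N.output (Fin.last m) (x n) - N.output (Fin.last m) a‖ ^ 2) atTop (𝓝 0))
    (i : Fin (m + 1)) :
    Tendsto (fun n => e i (N.output i (x n) - N.output i a) - (x n - a)) atTop (𝓝 0) := by
  let d : ∀ i, ℕ → H i := fun i n => N.output i (x n) - N.output i a
  have hstep : ∀ i : Fin m, ∃ c, 0 ≤ c ∧ ∀ n,
      0 ≤ ‖d i.castSucc n‖ ^ 2 - ‖d i.succ n‖ ^ 2 ∧
      ‖e i.succ (d i.succ n) - e i.castSucc (d i.castSucc n)‖ ^ 2
        ≤ c * (‖d i.castSucc n‖ ^ 2 - ‖d i.succ n‖ ^ 2) := by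
    intro i
    obtain ⟨β, hβ0, hβ1, hβ⟩ := hW i
    have h1β : 0 < 1 - β := by linarith
    refine ⟨β / (1 - β), by positivity, fun n => ?_⟩
    have h := norm_sq_le_of_layerwise _ hβ (N.norm_two_smul_output_sub_le hR i (x n) a)
    have heq : ∀ (u : H i.succ) (w : H i.castSucc), ‖e i.succ u - e i.castSucc w‖ =
        ‖u - ((e i.castSucc).trans (e i.succ).symm) w‖ := fun u w => by
      rw [← (e i.succ).norm_map (u - _), map_sub]
      simp
    refine ⟨nonneg_of_mul_nonneg_right ((by positivity : (0 : ℝ) ≤ _).trans h) hβ0, ?_⟩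
    rw [heq, div_mul_eq_mul_div, le_div_iff₀ h1β, mul_comm]
    exact h
  have hanti : ∀ i : Fin (m + 1), ∀ n, ‖d (Fin.last m) n‖ ^ 2 ≤ ‖d i n‖ ^ 2 := by
    intro i n
    induction i using Fin.reverseInduction with
    | last => exact le_rfl
    | cast i ih =>
      obtain ⟨c, -, hc⟩ := hstep i
      linarith [(hc n).1]
  have hmono : ∀ i : Fin (m + 1), ∀ n, ‖d i n‖ ^ 2 ≤ ‖x n - a‖ ^ 2 := by
    intro i n
    induction i using Fin.induction with
    | zero => exact le_rfl
    | succ i ih =>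
      obtain ⟨c, -, hc⟩ := hstep i
      linarith [(hc n).1]
  induction i using Fin.induction with
  | zero => simp [he0, N.output_zero]
  | succ i ih =>
    obtain ⟨c, hc0, hc⟩ := hstep i
    have h1 : Tendsto (fun n => ‖e i.succ (d i.succ n) - e i.castSucc (d i.castSucc n)‖ ^ 2)
        atTop (𝓝 0) := by
      refine squeeze_zero (fun n => by positivity) (fun n => (hc n).2.trans
        (mul_le_mul_of_nonneg_left (sub_le_sub (hmono i.castSucc n) (hanti i.succ n)) hc0)) ?_
      simpa using hx.const_mul c
    have h2 : Tendsto (fun n => e i.succ (d i.succ n) - e i.castSucc (d i.castSucc n))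
        atTop (𝓝 0) := by
      rw [tendsto_zero_iff_norm_tendsto_zero]
      simpa using h1.sqrt
    simpa [d] using h2.add ih

end Networks

end ProxNet

/-! ### Convergence of the network iteration -/

theorem theorem5p3 (m : ℕ) (hm : 1 ≤ m) (H : Fin (m + 1) → Type u)
    [∀ i, NormedAddCommGroup (H i)] [∀ i, InnerProductSpace ℝ (H i)]
    [∀ i, CompleteSpace (H i)] [∀ i, Nontrivial (H i)]
    (J : H (Fin.last m) ≃ₗᵢ[ℝ] H 0)
    (N : ℕ → ProxNet.Layers H) (lam : ℕ → ℝ) (hlam : ∀ n, 0 < lam n) (x₀ : H 0)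
    (N' : ProxNet.Layers H) (φ : ∀ i : Fin m, H i.succ → EReal)
    (hR : ∀ i, ProxNet.IsActivation (φ i) (N'.R i))
    (hN : ProxNet.SummablyClose N N')
    (α : ℝ) (hα : α ∈ Set.Icc (1 / 2 : ℝ) 1)
    (ha : (Function.fixedPoints (N'.comp J)).Nonempty)
    (hb : ProxNet.AveragedCondition J N'.W α)
    (hc : ((∀ n, lam n = 1) ∧ α = 1 ∧
          Tendsto (fun n => N'.comp J (ProxNet.iterate J N lam x₀ n)
            - ProxNet.iterate J N lam x₀ n) atTop (𝓝 0)) ∨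
        ((∀ n, lam n < 1 / α) ∧
          Tendsto (fun n => ∑ k ∈ Finset.range n, lam k * (1 - α * lam k)) atTop atTop)) :
    ∃ xbar ∈ Function.fixedPoints (N'.comp J),
      ProxNet.WeakLim (ProxNet.iterate J N lam x₀) xbar ∧
      ProxNet.SolvesVI J N' φ (fun i => N'.output i xbar) ∧
      (((∀ i : Fin m, i.succ ≠ Fin.last m → ProxNet.WeakSeqContinuous (N'.R i)) ∨
        (∀ i : Fin m, i.succ ≠ Fin.last m → ProxNet.IsSeparableActivation (N'.R i)) ∨
        (∀ i : Fin m, i.succ ≠ Fin.last m → FiniteDimensional ℝ (H i.succ)) ∨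
        ((∃ ε : ℝ, 0 < ε ∧ ε < 1 / 2 ∧
            ∀ n, ε ≤ lam n ∧ lam n ≤ (1 - ε) * (ε + 1 / α)) ∧
          ProxNet.LayerwiseAveraged J N'.W)) →
        (∀ i : Fin m, i.succ ≠ Fin.last m →
          ProxNet.WeakLim (ProxNet.layerOutput J N lam x₀ i.succ) (N'.output i.succ xbar)) ∧
        ProxNet.SolvesVI J N' φ (fun i => N'.output i xbar)) := by
  obtain ⟨hα1, hα2⟩ := hα
  have hα0 : 0 < α := by linarith
  obtain ⟨z, hz⟩ := ha
  have hTav := N'.comp_averaged hR hm hb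
  set T : H 0 → H 0 := N'.comp J
  set x := ProxNet.iterate J N lam x₀ with hxdef
  have hxs : ∀ n, x (n + 1) = x n + lam n • ((N n).comp J (x n) - x n) := fun n => rfl
  -- Q is defined by T = (1-α) Id + αQ; it has the fixed points of T, and averagedness of T is its
  -- nonexpansiveness.
  let Q : H 0 → H 0 := fun y => y + α⁻¹ • (T y - y)
  have hQT : ∀ y, T y - y = α • (Q y - y) := fun y => by
    simp only [Q, add_sub_cancel_left, smul_smul, mul_inv_cancel₀ hα0.ne', one_smul]
  have hQfix : ∀ y, Q y = y ↔ T y = y := fun y => by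
    rw [← sub_eq_zero (a := T y), hQT, smul_eq_zero, or_iff_right hα0.ne', sub_eq_zero]
  have hQ : ∀ y w, ‖Q y - Q w‖ ≤ ‖y - w‖ := by
    intro y w
    have e : T y - T w - (1 - α) • (y - w) = α • (Q y - Q w) := by
      rw [show T y - T w = (T y - y) - (T w - w) + (y - w) by abel, hQT, hQT]
      module
    have h := hTav y w
    rw [e, norm_smul, Real.norm_of_nonneg hα0.le] at h
    exact le_of_mul_le_mul_left h hα0
  have hlamα : ∀ n, α * lam n ≤ 1 := by
    intro n
    rcases hc with ⟨h1, h2, -⟩ | ⟨h1, -⟩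
    · rw [h1, h2, one_mul]
    · have := (lt_div_iff₀ hα0).1 (h1 n)
      linarith
  have ht : ∀ n, α * lam n ∈ Set.Icc (0 : ℝ) 1 := fun n =>
    ⟨mul_nonneg hα0.le (hlam n).le, hlamα n⟩
  -- The bound 2 comes from αλ_n ≤ 1 and α ≥ 1/2.
  have hlam2 : ∀ n, lam n ≤ 2 := fun n => by nlinarith [hlamα n, hlam n]
  obtain ⟨δ, hδ, hNδ⟩ := hN.exists_uniform
  obtain ⟨K, hK0, hK⟩ := ProxNet.Layers.norm_output_sub_le hR hδ hNδ (Fin.last m)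
  obtain ⟨a, hQa, hxa, hres, M, hM⟩ := ProxNet.krasnoselskii_mann hQ ((hQfix z).2 hz) ht
    (x := x) (e := fun n => lam n • ((N n).comp J (x n) - T (x n)))
    (fun n => by
      rw [hxs, mul_comm, mul_smul, ← hQT]
      module)
    (δ := fun n => 2 * (δ n * K))
    (fun n => mul_nonneg zero_le_two (mul_nonneg (hδ.1 n) hK0))
    ((hδ.2.mul_right K).mul_left 2)
    (fun n => by
      rw [norm_smul, Real.norm_of_nonneg (hlam n).le, mul_assoc]
      refine mul_le_mul (hlam2 n) ?_ (norm_nonneg _) zero_le_two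
      simpa only [T, ProxNet.Layers.comp, ← map_sub, J.norm_map] using hK n (x n))
    (by
      rcases hc with ⟨-, h2, h3⟩ | ⟨-, h2⟩
      · left
        rw [← tendsto_zero_iff_norm_tendsto_zero]
        simpa only [hQT, h2, one_smul] using h3
      · right
        refine (h2.const_mul_atTop hα0).congr fun n => ?_
        rw [Finset.mul_sum]
        exact Finset.sum_congr rfl fun k _ => by ring)
  have hTa : T a = a := (hQfix a).1 hQa
  have hVI := ProxNet.Layers.solvesVI hR hTa
  refine ⟨a, hTa, hxa, hVI, fun hd => ⟨?_, hVI⟩⟩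
  have hTres : Tendsto (fun n => T (x n) - x n) atTop (𝓝 0) := by
    simpa only [hQT, smul_zero] using
      (tendsto_zero_iff_norm_tendsto_zero.2 hres).const_smul α
  have hpert : ∀ i, Tendsto (fun n => ProxNet.layerOutput J N lam x₀ i n - N'.output i (x n))
      atTop (𝓝 0) := by
    intro i
    obtain ⟨C, hC0, hC⟩ := ProxNet.Layers.norm_output_sub_le hR hδ hNδ i
    refine squeeze_zero_norm (fun n => (hC n (x n)).trans (mul_le_mul_of_nonneg_left
      (add_le_add_left (hM n) 1) (mul_nonneg (hδ.1 n) hC0))) ?_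
    simpa using (hδ.2.tendsto_atTop_zero.mul_const C).mul_const (M + 1)
  suffices hlim : ∀ i : Fin m, i.succ ≠ Fin.last m →
      ProxNet.WeakLim (fun n => N'.output i.succ (x n)) (N'.output i.succ a) by
    intro i hi
    have := (hlim i hi).add_tendsto (hpert i.succ)
    simpa only [add_sub_cancel, add_zero] using this
  rcases hd with hd | hd | hd | ⟨-, e, he0, heJ, hW⟩
  · exact fun i hi => N'.weakLim_output hxa hd i.succ hi
  · exact fun i hi => N'.weakLim_output hxa
      (fun j hj => (hR j).weakSeqContinuous_of_isSeparable (hd j hj)) i.succ hi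
  · refine fun i hi => N'.weakLim_output hxa (fun j hj => ?_) i.succ hi
    have := hd j hj
    exact (hR j).weakSeqContinuous_of_finiteDimensional
  · intro i _
    -- Since Ta = a, the differences x_n - a and T x_n - T a are bounded and differ by the vanishing
    -- residual.
    have hsq : Tendsto (fun n => ‖x n - a‖ ^ 2
        - ‖N'.output (Fin.last m) (x n) - N'.output (Fin.last m) a‖ ^ 2) atTop (𝓝 0) := by
      have heq : ∀ n, ‖N'.output (Fin.last m) (x n) - N'.output (Fin.last m) a‖ ^ 2 =
          ‖(x n - a) + (T (x n) - x n)‖ ^ 2 := fun n => by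
        rw [← J.norm_map, map_sub]
        congr 2
        change T (x n) - T a = _
        rw [hTa]
        abel
      have hb1 : ∀ n, ‖x n - a‖ ≤ M + ‖a‖ := fun n =>
        (norm_sub_le _ _).trans (add_le_add_left (hM n) _)
      have hn := tendsto_zero_iff_norm_tendsto_zero.1 hTres
      refine squeeze_zero_norm (a := fun n => 2 * (M + ‖a‖) * ‖T (x n) - x n‖
        + ‖T (x n) - x n‖ ^ 2) (fun n => ?_) ?_
      · rw [heq, norm_add_sq_real, Real.norm_eq_abs]
        have h1 := abs_real_inner_le_norm (x n - a) (T (x n) - x n)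
        have h2 := mul_le_mul_of_nonneg_right (hb1 n) (norm_nonneg (T (x n) - x n))
        rw [abs_le] at h1 ⊢
        constructor <;> nlinarith [sq_nonneg ‖T (x n) - x n‖]
      · simpa using (hn.const_mul (2 * (M + ‖a‖))).add (hn.pow 2)
    have h0 := N'.tendsto_output_sub_of_layerwise hR e he0 hW hsq i.succ
    -- Carried to H_0, the layer output is x_n plus a constant plus a strongly vanishing term, so it
    -- inherits weak convergence.
    have h1 := (hxa.add_tendsto (tendsto_const_nhds (x := e i.succ (N'.output i.succ a) - a)
      |>.add h0)).map ((e i.succ).symm : H 0 →L[ℝ] H i.succ)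
    have hl : ∀ y, ((e i.succ).symm : H 0 →L[ℝ] H i.succ) y = (e i.succ).symm y := fun y => rfl
    convert h1 using 1
    · funext n
      rw [hl, LinearIsometryEquiv.eq_symm_apply, map_sub]
      abel
    · rw [hl, LinearIsometryEquiv.eq_symm_apply]
      abel
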